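/- Let $q$ be a prime power, let $n, I, J$ be positive integers with $I<J<n$, and let $\alpha,\beta,\gamma\in\mathbb{F}_{q^n}^*$. Put $K=J-I$, and let $$U=U_{\alpha,\beta,\gamma}^{I,J,n}:=\{(x,\,y,\,z,\;x^{q^I}+\alpha y^{q^J},\;x^{q^J}+\beta z^{q^I},\;y^{q^I}+\gamma z^{q^J}) : x,y,z\in\mathbb{F}_{q^n}\},$$ an $\mathbb{F}_q$-subspace of $\mathbb{F}_{q^n}^6$. Suppose that $\alpha\,\gamma^{q^{K}}\beta^{q^{K}+1}$ is not a $(q^{2K}+q^{K}+1)$-th power in $\mathbb{F}_{q^n}$, i.e. it is not equal to $\xi^{q^{2K}+q^K+1}$ for any $\xi\in\mathbb{F}_{q^n}$. Then $U$ is $(2,2J)_q$-evasive: every $2$-dimensional $\mathbb{F}_{q^n}$-subspace of $\mathbb{F}_{q^n}^6$ meets $U$ in an $\mathbb{F}_q$-subspace of dimension at most $2J$ over $\mathbb{F}_q$. -/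

import Mathlib

/-- For an extension `L / F` of finite fields, with `q = |F|`, the map `x ↦ x ^ (q ^ i)` on `L`
is additive. -/
theorem add_pow_card_pow_nat (F : Type*) {L : Type*} [Field F] [Finite F] [Field L] [Algebra F L]
    (i : ℕ) (x y : L) :
    (x + y) ^ (Nat.card F ^ i) = x ^ (Nat.card F ^ i) + y ^ (Nat.card F ^ i) := by
  haveI := Fintype.ofFinite F
  rw [Nat.card_eq_fintype_card]
  have h : ∀ z : L, ((FiniteField.frobeniusAlgHom F L) ^ i) z = z ^ (Fintype.card F ^ i) := by
    intro z
    rw [AlgHom.coe_pow, FiniteField.coe_frobeniusAlgHom, pow_iterate]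
  rw [← h, ← h, ← h, map_add]

/-- For an extension `L / F` of finite fields, with `q = |F|`, the map `x ↦ x ^ (q ^ i)` on `L`
is `F`-homogeneous. -/
theorem smul_pow_card_pow_nat {F L : Type*} [Field F] [Finite F] [Field L] [Algebra F L]
    (i : ℕ) (c : F) (x : L) :
    (c • x) ^ (Nat.card F ^ i) = c • x ^ (Nat.card F ^ i) := by
  haveI := Fintype.ofFinite F
  rw [Nat.card_eq_fintype_card, smul_pow, FiniteField.pow_card_pow]

/-- The `F`-subspace
`{(x, y, z, x^(q^I) + α y^(q^J), x^(q^J) + β z^(q^I), y^(q^I) + γ z^(q^J)) : x, y, z ∈ L}`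
of `L^6`, where `q = |F|`. -/
def scatteredSpace (F : Type*) {L : Type*} [Field F] [Finite F] [Field L] [Algebra F L]
    (I J : ℕ) (α β γ : L) : Submodule F (Fin 6 → L) where
  carrier := {v | ∃ x y z : L, v = ![x, y, z,
    x ^ (Nat.card F ^ I) + α * y ^ (Nat.card F ^ J),
    x ^ (Nat.card F ^ J) + β * z ^ (Nat.card F ^ I),
    y ^ (Nat.card F ^ I) + γ * z ^ (Nat.card F ^ J)]}
  zero_mem' := by
    have h : ∀ i : ℕ, (0 : L) ^ (Nat.card F ^ i) = 0 := fun i =>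
      zero_pow (pow_ne_zero _ Nat.card_pos.ne')
    refine ⟨0, 0, 0, ?_⟩
    funext j
    fin_cases j <;> simp [h]
  add_mem' := by
    rintro _ _ ⟨x, y, z, rfl⟩ ⟨x', y', z', rfl⟩
    refine ⟨x + x', y + y', z + z', ?_⟩
    funext j
    fin_cases j <;> simp [add_pow_card_pow_nat F] <;> ring
  smul_mem' := by
    rintro c _ ⟨x, y, z, rfl⟩
    refine ⟨c • x, c • y, c • z, ?_⟩
    funext j
    fin_cases j <;> simp only [smul_pow_card_pow_nat] <;> simp [smul_add]

/-- An `F`-subspace `U` of a finite-dimensional `L`-space `V` is `(h, r)_q`-evasive, `q = |F|`, if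
every `h`-dimensional `L`-subspace of `V` meets `U` in an `F`-subspace of dimension at most `r`. -/
def IsEvasive (F L : Type*) {V : Type*} [Field F] [Field L] [Algebra F L]
    [AddCommGroup V] [Module F V] [Module L V] [IsScalarTower F L V]
    (U : Submodule F V) (h r : ℕ) : Prop :=
  ∀ H : Submodule L V, Module.finrank L H = h →
    Module.finrank F ↥(U ⊓ H.restrictScalars F) ≤ r

/-- `A_{q,I,J} = q^(2K) + q^K + 1` with `K = J - I` (used for `I < J`). -/
def powerExponent (q I J : ℕ) : ℕ := q ^ (2 * (J - I)) + q ^ (J - I) + 1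

/-- `K_{α,β,γ}^{I,J} = α γ^(q^K) β^(q^K + 1)` with `K = J - I` (used for `I < J`). -/
def powerElement {L : Type*} [Field L] (q I J : ℕ) (α β γ : L) : L :=
  α * γ ^ (q ^ (J - I)) * β ^ (q ^ (J - I) + 1)

open Module

/-! Write q = |F|, let H be a plane and S = U ∩ H. There are two cases, according to whether the
first three coordinates separate the points of H.

If they do, two of them already span the dual of H. The equations of U express the q^J-th powers of
the first three coordinates through coordinates and q^I-th powers, so the 2J Frobenius powers
(exponents below J) of the chosen pair span an L-space of functions on S that is Frobenius-stable
and separates points. A trace argument (`finrank_le_finrank_of_frobenius_stable`) shows that such a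
space has L-dimension at least dim_F S, so dim_F S ≤ 2J.

Otherwise H is spanned by some h and a nonzero u supported on the last three coordinates, apart from
a trivial case. A point t h + r u of S is determined by t, and eliminating r from the equations of U
makes t a root of q-polynomials of q-degree at most J. If all of these degenerated, the coefficient
vectors at t^(q^I) and t^(q^J) would be proportional, making α γ^(q^K) β^(q^K+1) an excluded power
(`exists_powerElement_eq_pow`). Hence dim_F S ≤ J. -/

/-- The `F`-linear map `x ↦ x ^ (|F| ^ m)` on an extension `L` of a finite field `F`. -/
noncomputable def frobeniusPow (F L : Type*) [Field F] [Finite F] [Field L] [Algebra F L] (m : ℕ) :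
    L →ₗ[F] L where
  toFun x := x ^ (Nat.card F ^ m)
  map_add' := add_pow_card_pow_nat F m
  map_smul' := smul_pow_card_pow_nat m

/-! ### Frobenius-stable spaces of functions -/

section Frobenius

variable {F L : Type*} [Field F] [Finite F] [Field L] [Algebra F L]

@[simp]
theorem frobeniusPow_apply (m : ℕ) (x : L) : frobeniusPow F L m x = x ^ (Nat.card F ^ m) := rfl

theorem frobeniusPow_comp_smul {S : Type*} [AddCommGroup S] [Module F S] (m : ℕ) (a : L)
    (f : S →ₗ[F] L) :
    frobeniusPow F L m ∘ₗ (a • f) = a ^ (Nat.card F ^ m) • (frobeniusPow F L m ∘ₗ f) := by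
  ext s
  simp [mul_pow]

theorem frobeniusPow_comp_frobeniusPow_comp {S : Type*} [AddCommGroup S] [Module F S] (m k : ℕ)
    (f : S →ₗ[F] L) :
    frobeniusPow F L m ∘ₗ (frobeniusPow F L k ∘ₗ f) = frobeniusPow F L (k + m) ∘ₗ f := by
  ext s
  simp [← pow_mul, pow_add]

theorem frobeniusPow_zero_comp {S : Type*} [AddCommGroup S] [Module F S] (f : S →ₗ[F] L) :
    frobeniusPow F L 0 ∘ₗ f = f := by
  ext s
  simp

theorem frobeniusPow_comp_mem {S : Type*} [AddCommGroup S] [Module F S]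
    {M : Submodule L (S →ₗ[F] L)} (hM : ∀ f ∈ M, frobeniusPow F L 1 ∘ₗ f ∈ M) (m : ℕ)
    {f : S →ₗ[F] L} (hf : f ∈ M) : frobeniusPow F L m ∘ₗ f ∈ M := by
  induction m with
  | zero => rwa [frobeniusPow_zero_comp]
  | succ m ih =>
    rw [← frobeniusPow_comp_frobeniusPow_comp]
    exact hM _ ih

theorem pow_card_pow_finrank [FiniteDimensional F L] (x : L) :
    x ^ (Nat.card F ^ finrank F L) = x := by
  have : Finite L := Module.finite_of_finite F
  have := Fintype.ofFinite L
  rw [← Module.natCard_eq_pow_finrank, Nat.card_eq_fintype_card, FiniteField.pow_card]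

/-- A Frobenius-stable `L`-space of `F`-linear functions `S → L` which separates the points of `S`
has `L`-dimension at least `dim_F S`. -/
theorem finrank_le_finrank_of_frobenius_stable [FiniteDimensional F L] {S : Type*}
    [AddCommGroup S] [Module F S] [FiniteDimensional F S] (M : Submodule L (S →ₗ[F] L))
    [FiniteDimensional L M] (hM : ∀ f ∈ M, frobeniusPow F L 1 ∘ₗ f ∈ M)
    (hsep : ∀ s, (∀ f ∈ M, f s = 0) → s = 0) : finrank F S ≤ finrank L M := by
  have : Finite L := Module.finite_of_finite F
  let b := finBasis F S
  let ev : S → Dual L M := fun s =>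
    { toFun := fun f => (f : S →ₗ[F] L) s
      map_add' := fun _ _ => rfl
      map_smul' := fun _ _ => rfl }
  have hev : LinearIndependent L (fun i => ev (b i)) := by
    rw [Fintype.linearIndependent_iff]
    intro c hc i
    by_contra hi
    -- Scaling the relation makes its i-th coefficient y, of trace 1. Summing its Frobenius
    -- conjugates then gives an F-relation among the b j whose i-th coefficient is 1.
    obtain ⟨y, hy⟩ := Algebra.trace_surjective F L 1
    have h0 : ∀ f ∈ M, ∑ j, (y / c i * c j) * f (b j) = 0 := by
      intro f hf
      have := LinearMap.congr_fun hc ⟨f, hf⟩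
      simp only [LinearMap.sum_apply, LinearMap.smul_apply, smul_eq_mul,
        LinearMap.zero_apply] at this
      have h2 : ∑ j, c j * f (b j) = 0 := this
      simp only [mul_assoc]
      rw [← Finset.mul_sum, h2, mul_zero]
    have h1 : ∀ m < finrank F L, ∀ f ∈ M,
        ∑ j, (y / c i * c j) ^ (Nat.card F ^ m) * f (b j) = 0 := by
      intro m hm f hf
      -- With n = [L : F], apply the relation to f^(q^(n-m)) and raise to the power q^m: the
      -- coefficients get twisted, while the values of f return to themselves.
      have h2 := congrArg (frobeniusPow F L m)
        (h0 _ (frobeniusPow_comp_mem hM (finrank F L - m) hf))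
      rw [map_sum, map_zero] at h2
      rw [← h2]
      refine Finset.sum_congr rfl fun j _ => ?_
      simp only [frobeniusPow_apply, LinearMap.comp_apply]
      rw [mul_pow (y / c i * c j), ← pow_mul, ← pow_add, Nat.sub_add_cancel hm.le,
        pow_card_pow_finrank]
    have h3 : ∑ j, Algebra.trace F L (y / c i * c j) • b j = 0 := by
      refine hsep _ fun f hf => ?_
      rw [map_sum]
      simp only [map_smul, Algebra.smul_def, FiniteField.algebraMap_trace_eq_sum_pow F L,
        Finset.sum_mul]
      rw [Finset.sum_comm]
      exact Finset.sum_eq_zero fun m hm => h1 m (Finset.mem_range.mp hm) f hf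
    have h4 := Fintype.linearIndependent_iff.mp b.linearIndependent _ h3 i
    rw [div_mul_cancel₀ _ hi, hy] at h4
    exact one_ne_zero h4
  have := hev.fintype_card_le_finrank
  rw [Fintype.card_fin] at this
  exact this.trans_eq (Subspace.dual_finrank_eq (K := L) (V := M))

/-- If the `F`-linear functions `u 0, …, u (d - 1) : S → L` separate points, and the
`|F| ^ J`-th powers of them are `L`-combinations of the lower Frobenius powers,
then `dim_F S ≤ d * J`. -/
theorem finrank_le_mul_of_frobeniusPow_mem_span [FiniteDimensional F L] {S : Type*}
    [AddCommGroup S] [Module F S] [FiniteDimensional F S] {d J : ℕ} (hJ : 0 < J)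
    (u : Fin d → S →ₗ[F] L) (hsep : ∀ s, (∀ i, u i s = 0) → s = 0)
    (hu : ∀ i, frobeniusPow F L J ∘ₗ u i ∈
      Submodule.span L (Set.range fun p : Fin d × Fin J => frobeniusPow F L p.2 ∘ₗ u p.1)) :
    finrank F S ≤ d * J := by
  set g := fun p : Fin d × Fin J => frobeniusPow F L p.2 ∘ₗ u p.1 with hg
  have hmem : ∀ i m, m < J → frobeniusPow F L m ∘ₗ u i ∈ Submodule.span L (Set.range g) :=
    fun i m hm => Submodule.subset_span ⟨(i, ⟨m, hm⟩), rfl⟩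
  have : FiniteDimensional L (Submodule.span L (Set.range g)) :=
    FiniteDimensional.span_of_finite L (Set.finite_range g)
  refine (finrank_le_finrank_of_frobenius_stable (Submodule.span L (Set.range g))
    ?_ ?_).trans ((finrank_range_le_card g).trans (by simp))
  · intro f hf
    induction hf using Submodule.span_induction with
    | mem f hf =>
      obtain ⟨⟨i, m⟩, rfl⟩ := hf
      simp only [hg]
      rw [frobeniusPow_comp_frobeniusPow_comp]
      -- Frobenius leaves the generating set only from exponent J - 1, where `hu` applies.
      rcases (Nat.succ_le_of_lt m.2).lt_or_eq with h | h
      · exact hmem i _ h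
      · rw [← Nat.succ_eq_add_one, h]
        exact hu i
    | zero => rw [LinearMap.comp_zero]; exact zero_mem _
    | add f f' _ _ h h' => rw [LinearMap.comp_add]; exact add_mem h h'
    | smul a f _ h => rw [frobeniusPow_comp_smul]; exact Submodule.smul_mem _ _ h
  · intro s hs
    refine hsep s fun i => ?_
    have := hs _ (hmem i 0 hJ)
    rwa [frobeniusPow_zero_comp] at this

end Frobenius

/-- An `F`-space which embeds into the roots of a nonzero polynomial
`b X ^ (q ^ J) + a X ^ (q ^ I) - c X`, `0 < I < J`, `q = |F|`, has dimension at most `J`. -/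
theorem finrank_le_of_injective_of_root {F L : Type*} [Field F] [Finite F] [Field L]
    {S : Type*} [AddCommGroup S] [Module F S] [FiniteDimensional F S] {I J : ℕ} (hI : 0 < I) (hIJ : I < J) {a b c : L}
    (hab : a ≠ 0 ∨ b ≠ 0) (t : S → L) (ht : Function.Injective t)
    (hroot : ∀ s, a * t s ^ (Nat.card F ^ I) + b * t s ^ (Nat.card F ^ J) = c * t s) :
    finrank F S ≤ J := by
  classical
  open Polynomial in
  let P : L[X] := C b * X ^ (Nat.card F ^ J) + C a * X ^ (Nat.card F ^ I) - C c * X ^ 1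
  have hq : 1 < Nat.card F := Finite.one_lt_card
  have hqI : 1 < Nat.card F ^ I := Nat.one_lt_pow hI.ne' hq
  have hqIJ : Nat.card F ^ I < Nat.card F ^ J := Nat.pow_lt_pow_right hq hIJ
  have hP : P ≠ 0 := by
    intro h
    have h1 := congrArg (Polynomial.coeff · (Nat.card F ^ I)) h
    have h2 := congrArg (Polynomial.coeff · (Nat.card F ^ J)) h
    simp only [P, Polynomial.coeff_sub, Polynomial.coeff_add, Polynomial.coeff_C_mul_X_pow,
      Polynomial.coeff_zero] at h1 h2
    simp only [hqIJ.ne, hqIJ.ne', hqI.ne', (hqI.trans hqIJ).ne', if_true, if_false] at h1 h2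
    rcases hab with h | h
    · exact h (by simpa using h1)
    · exact h (by simpa using h2)
  have hdeg : P.natDegree ≤ Nat.card F ^ J := by
    refine (Polynomial.natDegree_sub_le_of_le (Polynomial.natDegree_add_le_of_degree_le
      (Polynomial.natDegree_C_mul_X_pow_le _ _)
      ((Polynomial.natDegree_C_mul_X_pow_le _ _).trans hqIJ.le))
      (Polynomial.natDegree_C_mul_X_pow_le _ _)).trans ?_
    exact max_le le_rfl (hqI.trans hqIJ).le
  have hmem : ∀ s, t s ∈ P.roots.toFinset := by
    intro s
    rw [Multiset.mem_toFinset, Polynomial.mem_roots hP, Polynomial.IsRoot]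
    simp only [P, Polynomial.eval_sub, Polynomial.eval_add, Polynomial.eval_C_mul,
      Polynomial.eval_X_pow, pow_one, Polynomial.eval_X]
    linear_combination hroot s
  have hcard : Nat.card S ≤ Nat.card F ^ J := by
    calc Nat.card S ≤ Nat.card P.roots.toFinset :=
          Nat.card_le_card_of_injective (fun s => (⟨t s, hmem s⟩ : P.roots.toFinset))
            fun s s' h => ht (congrArg Subtype.val h)
      _ = P.roots.toFinset.card := by
          rw [Nat.card_eq_fintype_card, Fintype.card_coe]
      _ ≤ P.natDegree := (Multiset.toFinset_card_le _).trans (Polynomial.card_roots' P)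
      _ ≤ Nat.card F ^ J := hdeg
  rw [Module.natCard_eq_pow_finrank (K := F)] at hcard
  exact (Nat.pow_le_pow_iff_right hq).mp hcard

/-! ### Separating functionals -/

section LinearAlgebra

variable {L : Type*} [Field L]

/-- Among three functionals without common zeros on a plane, two have no common zeros. -/
theorem exists_pair_separating {H : Type*} [AddCommGroup H] [Module L H] (hH : finrank L H = 2)
    (c : Fin 3 → Dual L H) (hsep : ∀ v, (∀ i, c i v = 0) → v = 0) :
    ∃ e : Fin 2 → Fin 3, ∀ v, (∀ i, c (e i) v = 0) → v = 0 := by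
  classical
  have hfin : FiniteDimensional L H := FiniteDimensional.of_finrank_pos (by omega)
  -- A plane cannot fill L^3, so the functionals satisfy a linear relation; one with nonzero
  -- coefficient is redundant.
  have hlt : LinearMap.range (LinearMap.pi c) < ⊤ := by
    refine lt_top_iff_ne_top.mpr fun h => ?_
    have h1 := LinearMap.finrank_range_le (LinearMap.pi c)
    rw [h, finrank_top, hH, Module.finrank_fin_fun] at h1
    omega
  obtain ⟨φ, hφ, hle⟩ := Submodule.exists_le_ker_of_lt_top _ hlt
  have hrel : ∀ v, ∑ i, c i v * φ (fun j => if i = j then 1 else 0) = 0 := by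
    intro v
    have h1 : φ (LinearMap.pi c v) = 0 := hle ⟨v, rfl⟩
    rw [LinearMap.pi_apply_eq_sum_univ] at h1
    simpa using h1
  obtain ⟨k, hk⟩ : ∃ k : Fin 3, φ (fun j => if k = j then 1 else 0) ≠ 0 := by
    by_contra! h
    refine hφ (LinearMap.ext fun x => ?_)
    rw [LinearMap.pi_apply_eq_sum_univ]
    simp [h]
  refine ⟨k.succAbove, fun v hv => hsep v fun i => ?_⟩
  rcases eq_or_ne i k with rfl | hi
  · have := hrel v
    rw [Fin.sum_univ_succAbove _ i] at this
    simpa [hv, hk] using this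
  · obtain ⟨j, rfl⟩ := Fin.exists_succAbove_eq hi
    exact hv j

/-- Functionals `u 0, …, u (d - 1)` without common zeros on a `d`-dimensional space span its
dual. -/
theorem exists_eq_sum_smul_of_separating {H : Type*} [AddCommGroup H] [Module L H]
    [FiniteDimensional L H] {d : ℕ} (hH : finrank L H = d) (u : Fin d → Dual L H)
    (hsep : ∀ v, (∀ i, u i v = 0) → v = 0) (g : Dual L H) :
    ∃ a : Fin d → L, ∀ v, g v = ∑ i, a i * u i v := by
  classical
  let e := LinearEquiv.ofInjectiveOfFinrankEq (LinearMap.pi u)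
    ((injective_iff_map_eq_zero _).mpr fun v hv => hsep v fun i => congrFun hv i)
    (by rw [hH, Module.finrank_fin_fun])
  have he : ∀ v i, e v i = u i v := fun v i => rfl
  refine ⟨fun i => g (e.symm fun j => if i = j then 1 else 0), fun v => ?_⟩
  have h1 := LinearMap.pi_apply_eq_sum_univ (g ∘ₗ e.symm.toLinearMap) (e v)
  simp only [LinearMap.comp_apply, LinearEquiv.coe_coe, LinearEquiv.symm_apply_apply, smul_eq_mul,
    he] at h1
  rw [h1]
  exact Finset.sum_congr rfl fun i _ => mul_comm _ _

end LinearAlgebra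

/-! ### The two kinds of planes -/

section Evasive

variable {F L : Type*} [Field F] [Finite F] [Field L] [Algebra F L]

/-- The bound `2 J` for the planes on which the first three coordinates have no common zero. -/
theorem finrank_inf_le_of_separating [FiniteDimensional F L] {I J : ℕ} (hIJ : I < J)
    {α β γ : L} (hα : α ≠ 0) (hγ : γ ≠ 0) {H : Submodule L (Fin 6 → L)} (hH : finrank L H = 2)
    (hsep : ∀ v ∈ H, v 0 = 0 → v 1 = 0 → v 2 = 0 → v = 0) :
    finrank F ↥(scatteredSpace F I J α β γ ⊓ H.restrictScalars F) ≤ 2 * J := by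
  have hJ : 0 < J := by omega
  set S := scatteredSpace F I J α β γ ⊓ H.restrictScalars F with hS
  let x : Fin 6 → S →ₗ[F] L := fun k =>
    ((LinearMap.proj k : (Fin 6 → L) →ₗ[L] L).restrictScalars F) ∘ₗ S.subtype
  have hx : ∀ k (s : S), x k s = s.1 k := fun _ _ => rfl
  let y : Fin 6 → Dual L H := fun k => LinearMap.proj k ∘ₗ H.subtype
  have hy : ∀ k (v : H), y k v = v.1 k := fun _ _ => rfl
  obtain ⟨e, he⟩ := exists_pair_separating hH (fun i => y (Fin.castAdd 3 i)) (by
    intro v hv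
    exact Subtype.ext (hsep v.1 v.2 (hv 0) (hv 1) (hv 2)))
  set M := Submodule.span L (Set.range fun p : Fin 2 × Fin J =>
    frobeniusPow F L p.2 ∘ₗ x (Fin.castAdd 3 (e p.1))) with hM
  have hlow : ∀ k m, m < J → frobeniusPow F L m ∘ₗ x k ∈ M := by
    intro k m hm
    obtain ⟨a, ha⟩ := exists_eq_sum_smul_of_separating hH _ he (y k)
    have h1 : x k = a 0 • x (Fin.castAdd 3 (e 0)) + a 1 • x (Fin.castAdd 3 (e 1)) := by
      ext s
      have := ha ⟨s.1, s.2.2⟩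
      rw [Fin.sum_univ_two] at this
      exact this
    rw [h1, LinearMap.comp_add, frobeniusPow_comp_smul, frobeniusPow_comp_smul]
    exact add_mem
      (Submodule.smul_mem _ _ (Submodule.subset_span ⟨(0, ⟨m, hm⟩), rfl⟩))
      (Submodule.smul_mem _ _ (Submodule.subset_span ⟨(1, ⟨m, hm⟩), rfl⟩))
  have hcoord : ∀ k, x k ∈ M := fun k => by
    simpa only [frobeniusPow_zero_comp] using hlow k 0 hJ
  have hU : ∀ s : S,
      s.1 3 = s.1 0 ^ (Nat.card F ^ I) + α * s.1 1 ^ (Nat.card F ^ J) ∧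
      s.1 4 = s.1 0 ^ (Nat.card F ^ J) + β * s.1 2 ^ (Nat.card F ^ I) ∧
      s.1 5 = s.1 1 ^ (Nat.card F ^ I) + γ * s.1 2 ^ (Nat.card F ^ J) := by
    intro s
    obtain ⟨a, b, c, h⟩ := s.2.1
    rw [h]
    exact ⟨rfl, rfl, rfl⟩
  have hhigh : ∀ i : Fin 3, frobeniusPow F L J ∘ₗ x (Fin.castAdd 3 i) ∈ M := by
    have h0 : frobeniusPow F L J ∘ₗ x 0 = x 4 - β • (frobeniusPow F L I ∘ₗ x 2) := by
      ext s
      have := (hU s).2.1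
      simp only [LinearMap.comp_apply, LinearMap.sub_apply, LinearMap.smul_apply, hx,
        frobeniusPow_apply, smul_eq_mul]
      linear_combination -this
    have h1 : frobeniusPow F L J ∘ₗ x 1 = α⁻¹ • (x 3 - frobeniusPow F L I ∘ₗ x 0) := by
      ext s
      have := (hU s).1
      simp only [LinearMap.comp_apply, LinearMap.sub_apply, LinearMap.smul_apply, hx,
        frobeniusPow_apply, smul_eq_mul]
      rw [this]
      field_simp
      ring
    have h2 : frobeniusPow F L J ∘ₗ x 2 = γ⁻¹ • (x 5 - frobeniusPow F L I ∘ₗ x 1) := by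
      ext s
      have := (hU s).2.2
      simp only [LinearMap.comp_apply, LinearMap.sub_apply, LinearMap.smul_apply, hx,
        frobeniusPow_apply, smul_eq_mul]
      rw [this]
      field_simp
      ring
    intro i
    fin_cases i
    · exact h0 ▸ sub_mem (hcoord 4) (Submodule.smul_mem _ _ (hlow 2 I hIJ))
    · exact h1 ▸ Submodule.smul_mem _ _ (sub_mem (hcoord 3) (hlow 0 I hIJ))
    · exact h2 ▸ Submodule.smul_mem _ _ (sub_mem (hcoord 5) (hlow 1 I hIJ))
  refine finrank_le_mul_of_frobeniusPow_mem_span hJ (fun i => x (Fin.castAdd 3 (e i))) ?_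
    fun i => hhigh (e i)
  intro s hs
  exact Subtype.ext (congrArg (fun v : H => v.1) (he ⟨s.1, s.2.2⟩ hs))

/-- If `(α b^(q^J), a^(q^J), γ c^(q^J))` is a multiple of `(a^(q^I), β c^(q^I), b^(q^I))`, then
`α γ^(q^K) β^(q^K + 1)`, `K = J - I`, is a `(q^(2K) + q^K + 1)`-th power. -/
theorem exists_powerElement_eq_pow {q I J : ℕ} (hq : 0 < q) (hIJ : I ≤ J)
    {α β γ a b c l : L} (hβ : β ≠ 0) (h : a ≠ 0 ∨ b ≠ 0 ∨ c ≠ 0)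
    (hα : α ≠ 0) (hγ : γ ≠ 0)
    (h1 : α * b ^ q ^ J = l * a ^ q ^ I) (h2 : a ^ q ^ J = l * (β * c ^ q ^ I))
    (h3 : γ * c ^ q ^ J = l * b ^ q ^ I) :
    ∃ ξ : L, powerElement q I J α β γ = ξ ^ powerExponent q I J := by
  have hJ : q ^ J = q ^ I * q ^ (J - I) := by rw [← pow_add, Nat.add_sub_cancel' hIJ]
  have hqI : q ^ I ≠ 0 := pow_ne_zero _ hq.ne'
  have hQ2 : q ^ (2 * (J - I)) = q ^ (J - I) * q ^ (J - I) := by rw [two_mul, pow_add]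
  rw [hJ, pow_mul] at h1 h2 h3
  unfold powerElement powerExponent
  rw [hQ2]
  have hQ : q ^ (J - I) ≠ 0 := pow_ne_zero _ hq.ne'
  -- With A, B, C the q^I-th powers of a, b, c, the system reads α B^Q = l A, A^Q = l β C, γ C^Q = l
  -- B.
  generalize q ^ (J - I) = Q at *
  replace h : a ^ q ^ I ≠ 0 ∨ b ^ q ^ I ≠ 0 ∨ c ^ q ^ I ≠ 0 := by
    simpa only [ne_eq, pow_eq_zero_iff hqI] using h
  generalize a ^ q ^ I = A at *
  generalize b ^ q ^ I = B at *
  generalize c ^ q ^ I = C at *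
  have hl : l ≠ 0 := by
    rintro rfl
    simp only [zero_mul, mul_eq_zero, pow_eq_zero_iff hQ, hα, hγ, false_or] at h1 h2 h3
    simp [h1, h2, h3] at h
  have hA : A ≠ 0 := by
    rintro rfl
    rw [mul_zero, mul_eq_zero, or_iff_right hα, pow_eq_zero_iff hQ] at h1
    rw [zero_pow hQ, eq_comm, mul_eq_zero, or_iff_right hl, mul_eq_zero, or_iff_right hβ] at h2
    simp [h1, h2] at h
  -- By the second equation this is A / C, written without C.
  refine ⟨l * β * A / A ^ Q, ?_⟩
  have e2 : A ^ (Q * Q) = l ^ Q * (β ^ Q * C ^ Q) := by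
    rw [pow_mul, h2, mul_pow, mul_pow]
  have e2' : A ^ (Q * Q * Q) = l ^ (Q * Q) * (β ^ (Q * Q) * C ^ (Q * Q)) := by
    rw [pow_mul, e2, mul_pow, mul_pow, ← pow_mul, ← pow_mul, ← pow_mul]
  have e3 : γ ^ Q * C ^ (Q * Q) = l ^ Q * B ^ Q := by
    rw [pow_mul, ← mul_pow, h3, mul_pow]
  have key : α * γ ^ Q * A ^ (Q * Q * Q) = l ^ (Q * Q) * β ^ (Q * Q) * l ^ Q * l * A := by
    linear_combination α * γ ^ Q * e2' + α * l ^ (Q * Q) * β ^ (Q * Q) * e3 +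
      l ^ (Q * Q) * β ^ (Q * Q) * l ^ Q * h1
  rw [div_pow, eq_div_iff (pow_ne_zero _ (pow_ne_zero _ hA)), ← pow_mul]
  have e4 : A ^ (Q * (Q * Q + Q + 1)) = A ^ (Q * Q * Q) * A ^ (Q * Q) * A ^ Q := by
    rw [← pow_add, ← pow_add]
    ring_nf
  rw [e4, pow_succ β, pow_succ (l * β * A), pow_add, mul_pow, mul_pow, mul_pow, mul_pow]
  linear_combination β ^ Q * β * A ^ (Q * Q) * A ^ Q * key

/-- The bound `J` for the planes on which the first three coordinates have a common zero. -/
theorem finrank_inf_le_of_mem_ker [FiniteDimensional F L] {I J : ℕ} (hI : 0 < I) (hIJ : I < J)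
    {α β γ : L} (hα : α ≠ 0) (hβ : β ≠ 0) (hγ : γ ≠ 0)
    (hK : ¬ ∃ ξ : L,
      powerElement (Nat.card F) I J α β γ = ξ ^ powerExponent (Nat.card F) I J)
    {H : Submodule L (Fin 6 → L)} (hH : finrank L H = 2)
    {u : Fin 6 → L} (huH : u ∈ H) (hu : u ≠ 0) (hu0 : u 0 = 0) (hu1 : u 1 = 0) (hu2 : u 2 = 0) :
    finrank F ↥(scatteredSpace F I J α β γ ⊓ H.restrictScalars F) ≤ J := by
  have hfL : Finite L := Module.finite_of_finite F
  have hq : 0 < Nat.card F := Nat.card_pos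
  set S := scatteredSpace F I J α β γ ⊓ H.restrictScalars F with hS
  have hU : ∀ s : S,
      s.1 3 = s.1 0 ^ (Nat.card F ^ I) + α * s.1 1 ^ (Nat.card F ^ J) ∧
      s.1 4 = s.1 0 ^ (Nat.card F ^ J) + β * s.1 2 ^ (Nat.card F ^ I) ∧
      s.1 5 = s.1 1 ^ (Nat.card F ^ I) + γ * s.1 2 ^ (Nat.card F ^ J) := by
    intro s
    obtain ⟨a, b, c, h⟩ := s.2.1
    rw [h]
    exact ⟨rfl, rfl, rfl⟩
  have hzero : ∀ s : S, s.1 0 = 0 → s.1 1 = 0 → s.1 2 = 0 → s = 0 := by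
    intro s h0 h1 h2
    have hp : ∀ m, (0 : L) ^ (Nat.card F ^ m) = 0 := fun m => zero_pow (pow_ne_zero _ hq.ne')
    obtain ⟨h3, h4, h5⟩ := hU s
    simp only [h0, h1, h2, hp, mul_zero, add_zero] at h3 h4 h5
    refine Subtype.ext (funext fun k => ?_)
    fin_cases k
    exacts [h0, h1, h2, h3, h4, h5]
  by_cases hproj : ∀ v ∈ H, ∀ k : Fin 3, v (Fin.castAdd 3 k) = 0
  · have : Subsingleton S := subsingleton_of_forall_eq 0 fun s =>
      hzero s (hproj _ s.2.2 0) (hproj _ s.2.2 1) (hproj _ s.2.2 2)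
    rw [finrank_zero_of_subsingleton]
    exact Nat.zero_le _
  push Not at hproj
  obtain ⟨v, hvH, k, hvk⟩ := hproj
  set k' := Fin.castAdd 3 k with hk'
  obtain ⟨h, hhH, hhk⟩ : ∃ h ∈ H, h k' = 1 :=
    ⟨(v k')⁻¹ • v, H.smul_mem _ hvH, by simp [hvk]⟩
  have huk : ∀ i : Fin 3, u (Fin.castAdd 3 i) = 0 := by
    intro i
    fin_cases i
    exacts [hu0, hu1, hu2]
  have huk' : u k' = 0 := huk k
  have hspan : ∀ w ∈ H, ∃ s : L, w = w k' • h + s • u := by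
    have hind : LinearIndependent L ![h, u] := by
      rw [LinearIndependent.pair_iff]
      intro s t hst
      have h1 := congrFun hst k'
      simp only [Pi.add_apply, Pi.smul_apply, hhk, huk', smul_eq_mul, mul_one, mul_zero,
        add_zero, Pi.zero_apply] at h1
      rw [h1, zero_smul, zero_add, smul_eq_zero] at hst
      exact ⟨h1, hst.resolve_right hu⟩
    have hle : Submodule.span L (Set.range ![h, u]) ≤ H := by
      rw [Submodule.span_le, Matrix.range_cons, Matrix.range_cons, Matrix.range_empty]
      simp [Set.insert_subset_iff, hhH, huH]
    have heq := Submodule.eq_of_le_of_finrank_eq hle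
      (by rw [finrank_span_eq_card hind, hH, Fintype.card_fin])
    intro w hw
    rw [← heq, Matrix.range_cons, Matrix.range_cons, Matrix.range_empty, Set.union_empty,
      Set.singleton_union, Submodule.mem_span_pair] at hw
    obtain ⟨s, t, rfl⟩ := hw
    refine ⟨t, ?_⟩
    simp only [Pi.add_apply, Pi.smul_apply, hhk, huk', smul_eq_mul, mul_one, mul_zero,
      add_zero]
  set t : S → L := fun s => s.1 k' with ht
  have hcoord : ∀ s : S, ∃ r : L, ∀ i, s.1 i = t s * h i + r * u i := by
    intro s
    obtain ⟨r, hr⟩ := hspan _ s.2.2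
    exact ⟨r, fun i => congrFun hr i⟩
  -- If t vanishes, the point is a multiple of u, so its first three coordinates vanish, and the
  -- equations of U kill the others.
  have htinj : Function.Injective t := by
    intro s s' hss
    rw [← sub_eq_zero]
    obtain ⟨r, hr⟩ := hcoord (s - s')
    have h0 : t (s - s') = 0 := sub_eq_zero.mpr hss
    rw [h0] at hr
    apply hzero <;> rw [hr] <;> simp [hu0, hu1, hu2]
  set A : Fin 3 → L :=
    ![h 0 ^ (Nat.card F ^ I), β * h 2 ^ (Nat.card F ^ I), h 1 ^ (Nat.card F ^ I)] with hA
  set B : Fin 3 → L :=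
    ![α * h 1 ^ (Nat.card F ^ J), h 0 ^ (Nat.card F ^ J), γ * h 2 ^ (Nat.card F ^ J)] with hB
  have heqn : ∀ s : S, ∃ r : L, ∀ i : Fin 3,
      A i * t s ^ (Nat.card F ^ I) + B i * t s ^ (Nat.card F ^ J) =
        t s * h (Fin.natAdd 3 i) + r * u (Fin.natAdd 3 i) := by
    intro s
    obtain ⟨r, hr⟩ := hcoord s
    obtain ⟨h3, h4, h5⟩ := hU s
    rw [hr 0, hr 1, hr 3, hu0, hu1, mul_zero, add_zero, add_zero, mul_pow, mul_pow] at h3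
    rw [hr 0, hr 2, hr 4, hu0, hu2, mul_zero, add_zero, add_zero, mul_pow, mul_pow] at h4
    rw [hr 1, hr 2, hr 5, hu1, hu2, mul_zero, add_zero, add_zero, mul_pow, mul_pow] at h5
    refine ⟨r, fun i => ?_⟩
    fin_cases i
    · refine Eq.trans ?_ h3.symm
      simp only [hA, hB, Fin.zero_eta, Matrix.cons_val_zero]
      ring
    · refine Eq.trans ?_ h4.symm
      simp only [hA, hB, Fin.mk_one, Matrix.cons_val]
      ring
    · refine Eq.trans ?_ h5.symm
      simp only [hA, hB, Fin.reduceFinMk, Matrix.cons_val]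
      ring
  -- These 2×2 minors are the coefficients left after eliminating r from equations i and j. If all
  -- vanished, A and B would both be proportional to the tail of u, so B would be a multiple of A,
  -- contradicting `hK`.
  obtain ⟨i, j, hij⟩ : ∃ i j : Fin 3,
      A i * u (Fin.natAdd 3 j) - A j * u (Fin.natAdd 3 i) ≠ 0 ∨
      B i * u (Fin.natAdd 3 j) - B j * u (Fin.natAdd 3 i) ≠ 0 := by
    by_contra! hcon
    obtain ⟨m, hm⟩ : ∃ m : Fin 3, u (Fin.natAdd 3 m) ≠ 0 := by
      by_contra! hu3
      refine hu (funext fun i => ?_)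
      fin_cases i
      exacts [hu0, hu1, hu2, hu3 0, hu3 1, hu3 2]
    have hh : h 0 ≠ 0 ∨ h 1 ≠ 0 ∨ h 2 ≠ 0 := by
      by_contra! h0
      have : h k' = 0 := by
        rw [hk']
        fin_cases k
        exacts [h0.1, h0.2.1, h0.2.2]
      rw [hhk] at this
      exact one_ne_zero this
    have hqI : Nat.card F ^ I ≠ 0 := pow_ne_zero _ hq.ne'
    have hAm : A m ≠ 0 := by
      intro h0
      have hall : ∀ i, A i = 0 := by
        intro i
        have := (hcon i m).1
        rw [h0, zero_mul, sub_zero, mul_eq_zero] at this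
        exact this.resolve_right hm
      have a0 : h 0 ^ (Nat.card F ^ I) = 0 := hall 0
      have a1 : β * h 2 ^ (Nat.card F ^ I) = 0 := hall 1
      have a2 : h 1 ^ (Nat.card F ^ I) = 0 := hall 2
      rw [mul_eq_zero, or_iff_right hβ] at a1
      rw [pow_eq_zero_iff hqI] at a0 a1 a2
      simp [a0, a1, a2] at hh
    have hmul : ∀ i, B i = B m / A m * A i := by
      intro i
      have e1 := (hcon i m).1
      have e2 := (hcon i m).2
      field_simp
      apply mul_right_cancel₀ hm
      linear_combination A m * e2 - B m * e1
    exact hK (exists_powerElement_eq_pow hq hIJ.le hβ hh hα hγ (hmul 0) (hmul 1) (hmul 2))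
  refine finrank_le_of_injective_of_root hI hIJ hij t htinj
    (c := h (Fin.natAdd 3 i) * u (Fin.natAdd 3 j) - h (Fin.natAdd 3 j) * u (Fin.natAdd 3 i)) ?_
  intro s
  obtain ⟨r, hr⟩ := heqn s
  linear_combination u (Fin.natAdd 3 j) * hr i - u (Fin.natAdd 3 i) * hr j

end Evasive

theorem mainTheorem4 {F L : Type*} [Field F] [Finite F] [Field L] [Algebra F L]
    [FiniteDimensional F L] (n I J : ℕ) (hn : Module.finrank F L = n)
    (hI : 0 < I) (hIJ : I < J) (hJn : J < n)
    (α β γ : L) (hα : α ≠ 0) (hβ : β ≠ 0) (hγ : γ ≠ 0)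
    (hK : ¬ ∃ ξ : L,
      powerElement (Nat.card F) I J α β γ = ξ ^ powerExponent (Nat.card F) I J) :
    IsEvasive F L (scatteredSpace F I J α β γ) 2 (2 * J) := by
  intro H hH
  by_cases hsep : ∀ v ∈ H, v 0 = 0 → v 1 = 0 → v 2 = 0 → v = 0
  · exact finrank_inf_le_of_separating hIJ hα hγ hH hsep
  · push Not at hsep
    obtain ⟨u, huH, hu0, hu1, hu2, hu⟩ := hsep
    exact (finrank_inf_le_of_mem_ker hI hIJ hα hβ hγ hK hH huH hu hu0 hu1 hu2).trans (by omega)
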